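/- Let $m \ge 1$ and let $D \subset \mathbb{Z}^m \setminus \{\mathbf{0}\}$ be a finite set with $D = -D$. For $n \ge 1$ let $G_n$ be the graph (possibly with loops) with vertex set $\{0, \ldots, n-1\}^m$ in which $u$ and $v$ are adjacent if and only if there is $d \in D$ with $u_i - v_i \equiv d_i \pmod n$ for all $i = 1, \ldots, m$. Let $\alpha(G_n)$ be the largest size of an independent set of $G_n$, that is, of a set of vertices no two of which, equal or not, are adjacent. Let $\lambda_m$ be the Lebesgue measure on the torus $\mathbb{T}^m = \{ z \in \mathbb{C}^m : |z_1| = \dots = |z_m| = 1 \}$, normalized so that $\lambda_m(\mathbb{T}^m) = 1$. Let $F_D$ be the set of all non-zero complex Laurent polynomials $$f(z) = \sum_{d \in D} c_d\, z_1^{d_1} \cdots z_m^{d_m} \quad \text{with } c_{-d} = \overline{c_d} \text{ for all } d \in D;$$ such $f$ take real values on $\mathbb{T}^m$. For $f \in F_D$ put $$\rho_+(f) = \lambda_m(\{ z \in \mathbb{T}^m : f(z) > 0 \}), \qquad \rho_-(f) = \lambda_m(\{ z \in \mathbb{T}^m : f(z) < 0 \}).$$ Then the limit $$\alpha(D) =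 \lim_{n \to \infty} \frac{\alpha(G_n)}{n^m}$$ exists, and $\alpha(D) \le \min(\rho_+(f), \rho_-(f))$ for every $f \in F_D$. Moreover, if $D \ne \emptyset$, then $\min(\rho_+(f), \rho_-(f))$ attains a least value $\rho(D)$ on $F_D$, and $\alpha(D) \le \rho(D)$. -/

import Mathlib

open Filter Topology MeasureTheory

namespace MCirculant

/-- The `m`-circulant graph `G_n` with difference set `D`: its vertex set is `{0, …, n - 1}^m`, and
`u`, `v` are adjacent when `u - v` is congruent to some `d ∈ D` modulo `n` in every coordinate.
`Digraph` (a bare adjacency relation) is used because `G_n` may have loops for small `n`;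
for `D = -D` the relation is symmetric, see `circulantGraph_adj_symm`. -/
def circulantGraph {m : ℕ} (D : Finset (Fin m → ℤ)) (n : ℕ) : Digraph (Fin m → Fin n) where
  Adj u v := ∃ d ∈ D, ∀ i, ((u i : ℕ) : ℤ) - ((v i : ℕ) : ℤ) ≡ d i [ZMOD (n : ℤ)]

theorem circulantGraph_adj_symm {m : ℕ} {D : Finset (Fin m → ℤ)} (hD : ∀ d ∈ D, -d ∈ D) (n : ℕ)
    {u v : Fin m → Fin n} (h : (circulantGraph D n).Adj u v) : (circulantGraph D n).Adj v u := by
  obtain ⟨d, hd, h⟩ := h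
  refine ⟨-d, hD d hd, fun i => ?_⟩
  have := (h i).neg
  rwa [neg_sub] at this

/-- A set of vertices is independent if no two of its elements, equal or not, are adjacent
(so a vertex that carries a loop lies in no independent set). -/
def IsIndependent {V : Type*} (G : Digraph V) (S : Finset V) : Prop :=
  ∀ u ∈ S, ∀ v ∈ S, ¬ G.Adj u v

open Classical in
/-- `α(G)`: the size of a maximum independent set of a finite graph. -/
noncomputable def indepNum {V : Type*} [Fintype V] (G : Digraph V) : ℕ :=
  (Finset.univ.filter (fun S : Finset V => IsIndependent G S)).sup Finset.card

/-- `α_n = α(G_n) / n^m`. -/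
noncomputable def indepRatio {m : ℕ} (D : Finset (Fin m → ℤ)) (n : ℕ) : ℝ :=
  (indepNum (circulantGraph D n) : ℝ) / (n : ℝ) ^ m

/-- `α(D) = lim_{n → ∞} α(G_n) / n^m`. -/
noncomputable def alpha {m : ℕ} (D : Finset (Fin m → ℤ)) : ℝ :=
  limUnder atTop (indepRatio D)

noncomputable instance instMeasurableSpaceCircle : MeasurableSpace Circle := borel Circle

instance instBorelSpaceCircle : BorelSpace Circle := ⟨rfl⟩

/-- The map `(θ_1, …, θ_m) ↦ (exp(2πi θ_1), …, exp(2πi θ_m))` from `ℝ^m` to the torus. -/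
noncomputable def torusExp (m : ℕ) (θ : Fin m → ℝ) : Fin m → Circle :=
  fun j => Circle.exp (2 * Real.pi * θ j)

/-- The normalized Lebesgue measure `λ_m` on the torus `𝕋^m`: the image of the Lebesgue measure on
`[0, 1)^m` under `torusExp`. -/
noncomputable def torusMeasure (m : ℕ) : Measure (Fin m → Circle) :=
  ((volume : Measure (Fin m → ℝ)).restrict
    (Set.univ.pi fun _ => Set.Ico (0 : ℝ) 1)).map (torusExp m)

theorem measurable_torusExp (m : ℕ) : Measurable (torusExp m) := by
  unfold torusExp
  refine measurable_pi_lambda _ fun j => ?_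
  exact (Circle.exp.continuous.comp (by fun_prop)).measurable

instance isProbabilityMeasure_torusMeasure (m : ℕ) : IsProbabilityMeasure (torusMeasure m) := by
  constructor
  rw [torusMeasure, Measure.map_apply (measurable_torusExp m) MeasurableSet.univ]
  simp [volume_pi_pi]

/-- The value `f(z) = ∑_d c_d z_1^{d_1} ⋯ z_m^{d_m}` of a complex Laurent polynomial in `m`
variables at a point of the torus. -/
noncomputable def laurentEval {m : ℕ} (f : AddMonoidAlgebra ℂ (Fin m → ℤ))
    (z : Fin m → Circle) : ℂ :=
  f.coeff.sum fun d c => c * ∏ j, (z j : ℂ) ^ (d j)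

/-- `f` is a non-zero Laurent polynomial of the form `∑_{d ∈ D} c_d z^d` with
`c_{-d} = conj c_d` for all `d ∈ D`. -/
structure IsAdmissible {m : ℕ} (D : Finset (Fin m → ℤ))
    (f : AddMonoidAlgebra ℂ (Fin m → ℤ)) : Prop where
  ne_zero : f ≠ 0
  supported : ∀ d, d ∉ D → f.coeff d = 0
  conj_symm : ∀ d ∈ D, f.coeff (-d) = (starRingEnd ℂ) (f.coeff d)

/-- An admissible Laurent polynomial is real-valued on the torus. -/
theorem laurentEval_im {m : ℕ} {D : Finset (Fin m → ℤ)} (hD : ∀ d ∈ D, -d ∈ D)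
    {f : AddMonoidAlgebra ℂ (Fin m → ℤ)} (hf : IsAdmissible D f) (z : Fin m → Circle) :
    (laurentEval f z).im = 0 := by
  have hs : f.coeff.support ⊆ D := fun d hd => by
    by_contra h
    exact (Finsupp.mem_support_iff.1 hd) (hf.supported d h)
  have he : laurentEval f z = ∑ d ∈ D, f.coeff d * ∏ j, (z j : ℂ) ^ (d j) :=
    Finsupp.sum_of_support_subset _ hs _ (by simp)
  rw [← Complex.conj_eq_iff_im, he, map_sum]
  refine Finset.sum_bij' (fun d _ => -d) (fun d _ => -d) (fun d hd => hD d hd)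
    (fun d hd => hD d hd) (by simp) (by simp) (fun d hd => ?_)
  rw [hf.conj_symm d hd, map_mul, map_prod]
  congr 1
  refine Finset.prod_congr rfl fun j _ => ?_
  rw [map_zpow₀, Pi.neg_apply, zpow_neg, ← inv_zpow, ← Circle.coe_inv, Circle.coe_inv_eq_conj]

/-- `ρ₊(f)`: the measure of the set of points of the torus where the (real) value of `f` is
positive. -/
noncomputable def rhoPos {m : ℕ} (f : AddMonoidAlgebra ℂ (Fin m → ℤ)) : ℝ :=
  (torusMeasure m).real {z | 0 < (laurentEval f z).re}

/-- `ρ₋(f)`: the measure of the set of points of the torus where the (real) value of `f` is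
negative. -/
noncomputable def rhoNeg {m : ℕ} (f : AddMonoidAlgebra ℂ (Fin m → ℤ)) : ℝ :=
  (torusMeasure m).real {z | (laurentEval f z).re < 0}

/-- The set of values of `min(ρ₊(f), ρ₋(f))` over all admissible `f`. -/
def rhoValues {m : ℕ} (D : Finset (Fin m → ℤ)) : Set ℝ :=
  {x | ∃ f : AddMonoidAlgebra ℂ (Fin m → ℤ), IsAdmissible D f ∧ x = min (rhoPos f) (rhoNeg f)}

/-- `ρ(D)`: the least value of `min(ρ₊(f), ρ₋(f))` over all admissible `f`. -/
noncomputable def rho {m : ℕ} (D : Finset (Fin m → ℤ)) : ℝ :=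
  sInf (rhoValues D)

end MCirculant

/-!
Two arguments carry the theorem.

*The limit.* If `R` bounds the coordinates of all `d ∈ D`, then copies of an independent set of
`G_n`, placed in `G_N` in the blocks of a cubical grid with gaps of width `R`, form an independent
set, so that `⌊N / (n + R)⌋^m α(G_n) ≤ α(G_N)` (`pow_mul_indepNum_le`). Hence `α(G_N) / N^m` tends
to `sup_n α(G_n) / (n + R)^m` (`exists_tendsto_indepRatio`).

*The bound.* Let `f` be admissible and `w` a point of the torus. The Hermitian matrix on the vertices
of `G_n` with symbol `z ↦ f (w z)` has the characters as eigenvectors, with the values of `f` on the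
translate by `w` of the grid of `n`-th roots of unity as eigenvalues, and its quadratic form vanishes
on functions that live on an independent set. So an independent set is at most as large as the number
of non-positive eigenvalues (`card_le_card_laurentEval_nonpos`). The left-hand side does not depend
on `w`; averaging over `w` with the invariant measure of the torus gives `α(G_n) / n^m ≤ λ_m(f ≤ 0)`
for every `n ≥ 1`, with no equidistribution argument (`indepNum_le_measureReal_nonpos`). As the zero
set of `f` is a null set (`torusMeasure_laurentEval_eq_zero`), the right-hand side is `ρ₋(f)`, and
replacing `f` by `-f` gives `ρ₊(f)`.

The least value of `min(ρ₊, ρ₋)` exists because `ρ₊` and `ρ₋` are invariant under scaling of `f` by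
positive reals and continuous in the coefficients, again because zero sets are null sets, while the
admissible coefficient vectors of norm one form a compact set (`isLeast_rho`).
-/

namespace MCirculant

/-! ### Laurent monomials on the torus -/

/-- The Laurent monomial `z ↦ z_1^{d_1} ⋯ z_m^{d_m}` as a circle-valued function on the torus. -/
noncomputable def torusMonomial {m : ℕ} (d : Fin m → ℤ) (z : Fin m → Circle) : Circle :=
  ∏ j, z j ^ d j

variable {m : ℕ}

theorem torusMonomial_mul (d : Fin m → ℤ) (z w : Fin m → Circle) :
    torusMonomial d (z * w) = torusMonomial d z * torusMonomial d w := by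
  simp [torusMonomial, mul_zpow, Finset.prod_mul_distrib]

theorem torusMonomial_add (d e : Fin m → ℤ) (z : Fin m → Circle) :
    torusMonomial (d + e) z = torusMonomial d z * torusMonomial e z := by
  simp [torusMonomial, zpow_add, Finset.prod_mul_distrib]

theorem torusMonomial_sub (d e : Fin m → ℤ) (z : Fin m → Circle) :
    torusMonomial (d - e) z = torusMonomial d z / torusMonomial e z := by
  simp_rw [torusMonomial, ← Finset.prod_div_distrib, Pi.sub_apply, zpow_sub, div_eq_mul_inv]

theorem coe_torusMonomial (d : Fin m → ℤ) (z : Fin m → Circle) :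
    (torusMonomial d z : ℂ) = ∏ j, (z j : ℂ) ^ d j := by
  rw [torusMonomial]
  refine (map_prod Circle.coeHom _ _).trans (Finset.prod_congr rfl fun j _ => ?_)
  exact Circle.coe_zpow _ _

theorem continuous_torusMonomial (d : Fin m → ℤ) : Continuous (torusMonomial d) := by
  unfold torusMonomial
  fun_prop

theorem laurentEval_eq_sum {D : Finset (Fin m → ℤ)} {f : AddMonoidAlgebra ℂ (Fin m → ℤ)}
    (hf : ∀ d, d ∉ D → f.coeff d = 0) (z : Fin m → Circle) :
    laurentEval f z = ∑ d ∈ D, f.coeff d * (torusMonomial d z : ℂ) := by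
  have hs : f.coeff.support ⊆ D := fun d hd => by
    by_contra h
    exact (Finsupp.mem_support_iff.1 hd) (hf d h)
  have he : laurentEval f z = ∑ d ∈ D, f.coeff d * ∏ j, (z j : ℂ) ^ (d j) :=
    Finsupp.sum_of_support_subset _ hs _ (by simp)
  simp_rw [he, coe_torusMonomial]

theorem continuous_laurentEval (f : AddMonoidAlgebra ℂ (Fin m → ℤ)) :
    Continuous (laurentEval f) := by
  have h := laurentEval_eq_sum (f := f) (D := f.coeff.support)
    (fun d hd => Finsupp.notMem_support_iff.1 hd)
  rw [funext h]
  exact continuous_finsetSum _ fun d _ =>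
    continuous_const.mul (continuous_subtype_val.comp (continuous_torusMonomial d))

/-! ### Orthogonality on the grid of roots of unity -/

/-- The point of the torus whose `j`-th coordinate is `exp (2πi k_j / n)`. -/
noncomputable def rootPoint (n : ℕ) (k : Fin m → Fin n) : Fin m → Circle :=
  fun j => Circle.exp (2 * Real.pi / n) ^ (k j : ℕ)

theorem isPrimitiveRoot_exp {n : ℕ} (hn : n ≠ 0) :
    IsPrimitiveRoot (Circle.exp (2 * Real.pi / n) : ℂ) n := by
  convert Complex.isPrimitiveRoot_exp n hn using 1
  rw [Circle.coe_exp]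
  congr 1
  push_cast
  ring

theorem sum_zpow_pow_of_isPrimitiveRoot {n : ℕ} {ζ : ℂ} (hζ : IsPrimitiveRoot ζ n) (e : ℤ) :
    ∑ i : Fin n, ((ζ ^ e) ^ (i : ℕ)) = if (n : ℤ) ∣ e then (n : ℂ) else 0 := by
  rw [Fin.sum_univ_eq_sum_range (fun i => (ζ ^ e) ^ i)]
  split_ifs with h
  · simp [(hζ.zpow_eq_one_iff_dvd e).2 h]
  · have h1 : ζ ^ e ≠ 1 := fun h' => h ((hζ.zpow_eq_one_iff_dvd e).1 h')
    rw [geom_sum_eq h1, ← zpow_natCast, ← zpow_mul, mul_comm, zpow_mul, zpow_natCast,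
      hζ.pow_eq_one, one_zpow, sub_self, zero_div]

theorem sum_torusMonomial_rootPoint {n : ℕ} (hn : n ≠ 0) (e : Fin m → ℤ) :
    ∑ k : Fin m → Fin n, (torusMonomial e (rootPoint n k) : ℂ) =
      if ∀ j, (n : ℤ) ∣ e j then (n : ℂ) ^ m else 0 := by
  have h (k : Fin m → Fin n) : (torusMonomial e (rootPoint n k) : ℂ) =
      ∏ j, (((Circle.exp (2 * Real.pi / n) : ℂ) ^ e j) ^ (k j : ℕ)) := by
    rw [coe_torusMonomial]
    refine Finset.prod_congr rfl fun j _ => ?_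
    rw [rootPoint, Circle.coe_pow, ← zpow_natCast, ← zpow_natCast, ← zpow_mul, ← zpow_mul,
      mul_comm (e j)]
  have h2 := Finset.prod_univ_sum (fun _ : Fin m => (Finset.univ : Finset (Fin n)))
    fun j i => (((Circle.exp (2 * Real.pi / n) : ℂ) ^ e j) ^ (i : ℕ))
  rw [Fintype.piFinset_univ] at h2
  rw [Finset.sum_congr rfl fun k _ => h k, ← h2,
    Finset.prod_congr rfl fun j _ => sum_zpow_pow_of_isPrimitiveRoot (isPrimitiveRoot_exp hn) (e j)]
  split_ifs with h'
  · simp [h']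
  · obtain ⟨j, hj⟩ := not_forall.1 h'
    exact Finset.prod_eq_zero (Finset.mem_univ j) (if_neg hj)

/-! ### The inertia bound -/

/-- A vertex of the circulant graph as an integer vector. -/
def vertexVec {n : ℕ} (u : Fin m → Fin n) : Fin m → ℤ := fun j => ((u j : ℕ) : ℤ)

/-- The discrete Fourier transform on `{0, …, n - 1}^m` of a function that lives on the finite
set `S`. -/
noncomputable def gridFourier {n : ℕ} (S : Finset (Fin m → Fin n)) (x : S → ℂ)
    (k : Fin m → Fin n) : ℂ :=
  ∑ u : S, x u * (torusMonomial (vertexVec (u : Fin m → Fin n)) (rootPoint n k) : ℂ)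

/-- The weighted Plancherel formula: multiplying the power spectrum by a monomial in the frequency
correlates `x` with its shift. -/
theorem sum_torusMonomial_mul_gridFourier {n : ℕ} (hn : n ≠ 0) (S : Finset (Fin m → Fin n))
    (x : S → ℂ) (e : Fin m → ℤ) :
    ∑ k, (torusMonomial e (rootPoint n k) : ℂ) *
        (gridFourier S x k * starRingEnd ℂ (gridFourier S x k)) =
      ∑ u : S, ∑ v : S, x u * starRingEnd ℂ (x v) *
        if ∀ j, (n : ℤ) ∣ (e + vertexVec (u : Fin m → Fin n) - vertexVec (v : Fin m → Fin n)) j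
        then (n : ℂ) ^ m else 0 := by
  simp_rw [← sum_torusMonomial_rootPoint hn, gridFourier, map_sum, Finset.sum_mul_sum,
    Finset.mul_sum]
  rw [Finset.sum_comm]
  refine Finset.sum_congr rfl fun u _ => ?_
  rw [Finset.sum_comm]
  refine Finset.sum_congr rfl fun v _ => Finset.sum_congr rfl fun k _ => ?_
  rw [torusMonomial_sub, torusMonomial_add, div_eq_mul_inv, map_mul, Circle.coe_mul,
    Circle.coe_mul, Circle.coe_inv_eq_conj]
  ring

theorem vertexVec_sub_dvd_iff {n : ℕ} {u v : Fin m → Fin n} :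
    (∀ j, (n : ℤ) ∣ (vertexVec u - vertexVec v) j) ↔ u = v := by
  refine ⟨fun h => funext fun j => Fin.ext ?_, fun h => by simp [h]⟩
  have h1 := h j
  simp only [vertexVec, Pi.sub_apply] at h1
  have h2 : ((v j : ℕ) : ℤ) ≡ (u j : ℕ) [ZMOD n] := (Int.modEq_iff_dvd).2 h1
  have h3 := (Int.natCast_modEq_iff.1 h2)
  exact (h3.eq_of_lt_of_lt (v j).2 (u j).2).symm

theorem gridFourier_eq_zero {n : ℕ} (hn : n ≠ 0) {S : Finset (Fin m → Fin n)}
    {x : S → ℂ} (h : ∀ k, gridFourier S x k = 0) : x = 0 := by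
  have key := sum_torusMonomial_mul_gridFourier hn S x 0
  simp only [h, zero_mul, mul_zero, Finset.sum_const_zero, zero_add, vertexVec_sub_dvd_iff,
    Subtype.coe_inj, mul_ite, Finset.sum_ite_eq, Finset.mem_univ, if_true] at key
  rw [← Finset.sum_mul, eq_comm, mul_eq_zero, or_iff_left (by simp [hn])] at key
  simp_rw [Complex.mul_conj] at key
  rw [← Complex.ofReal_sum, Complex.ofReal_eq_zero,
    Finset.sum_eq_zero_iff_of_nonneg fun u _ => Complex.normSq_nonneg _] at key
  exact funext fun u => Complex.normSq_eq_zero.1 (key u (Finset.mem_univ u))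

/-- The quadratic form of the Hermitian circulant matrix with symbol `z ↦ f (w z)` vanishes on
functions that live on an independent set. -/
theorem sum_laurentEval_mul_gridFourier {n : ℕ} (hn : n ≠ 0) {D : Finset (Fin m → ℤ)}
    {f : AddMonoidAlgebra ℂ (Fin m → ℤ)} (hf : ∀ d, d ∉ D → f.coeff d = 0)
    {S : Finset (Fin m → Fin n)} (hS : IsIndependent (circulantGraph D n) S) (x : S → ℂ)
    (w : Fin m → Circle) :
    ∑ k, laurentEval f (w * rootPoint n k) *
        (gridFourier S x k * starRingEnd ℂ (gridFourier S x k)) = 0 := by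
  simp_rw [laurentEval_eq_sum hf, torusMonomial_mul, Circle.coe_mul, Finset.sum_mul]
  rw [Finset.sum_comm]
  refine Finset.sum_eq_zero fun d hd => ?_
  simp_rw [← mul_assoc (f.coeff d), mul_assoc (f.coeff d * _)]
  rw [← Finset.mul_sum, sum_torusMonomial_mul_gridFourier hn]
  refine mul_eq_zero_of_right _ (Finset.sum_eq_zero fun u _ => Finset.sum_eq_zero fun v _ =>
    mul_eq_zero_of_right _ (if_neg fun h => ?_))
  refine hS v v.2 u u.2 ⟨d, hd, fun i => (Int.modEq_iff_dvd).2 ?_⟩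
  have := h i
  simp only [vertexVec, Pi.sub_apply, Pi.add_apply] at this
  convert this using 1
  ring

open Classical in
/-- The inertia bound: an independent set is at most as large as the number of non-positive
eigenvalues of the Hermitian circulant matrix with symbol `z ↦ f (w z)`, whose eigenvalues are the
values of `f` on a translate of the grid of roots of unity. -/
theorem card_le_card_laurentEval_nonpos {n : ℕ} (hn : n ≠ 0) {D : Finset (Fin m → ℤ)}
    {f : AddMonoidAlgebra ℂ (Fin m → ℤ)} (hf : ∀ d, d ∉ D → f.coeff d = 0)
    {S : Finset (Fin m → Fin n)} (hS : IsIndependent (circulantGraph D n) S)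
    (w : Fin m → Circle) :
    S.card ≤ (Finset.univ.filter fun k : Fin m → Fin n =>
      (laurentEval f (w * rootPoint n k)).re ≤ 0).card := by
  set Q := Finset.univ.filter fun k : Fin m → Fin n =>
      (laurentEval f (w * rootPoint n k)).re ≤ 0 with hQ
  by_contra! hlt
  -- By counting dimensions, a non-zero function on `S` has all its frequencies outside `Q`.
  let T : (S → ℂ) →ₗ[ℂ] (Q → ℂ) :=
    { toFun := fun x k => gridFourier S x k
      map_add' := fun x y => funext fun k => by
        simp [gridFourier, add_mul, Finset.sum_add_distrib]
      map_smul' := fun a x => funext fun k => by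
        simp [gridFourier, mul_assoc, Finset.mul_sum] }
  have hker : LinearMap.ker T ≠ ⊥ := LinearMap.ker_ne_bot_of_finrank_lt (by simpa using hlt)
  obtain ⟨x, hx, hx0⟩ := (Submodule.ne_bot_iff _).1 hker
  have hxQ (k) (hk : (laurentEval f (w * rootPoint n k)).re ≤ 0) : gridFourier S x k = 0 :=
    congrFun (LinearMap.mem_ker.1 hx) ⟨k, by simp [hQ, hk]⟩
  refine hx0 (gridFourier_eq_zero hn fun k => ?_)
  have h0 := congrArg Complex.re (sum_laurentEval_mul_gridFourier hn hf hS x w)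
  simp_rw [Complex.mul_conj, Complex.re_sum, Complex.re_mul_ofReal, Complex.zero_re] at h0
  rw [Finset.sum_eq_zero_iff_of_nonneg fun k _ => ?_] at h0
  · rcases mul_eq_zero.1 (h0 k (Finset.mem_univ k)) with h | h
    · exact hxQ k h.le
    · exact Complex.normSq_eq_zero.1 h
  · rcases le_or_gt (laurentEval f (w * rootPoint n k)).re 0 with h | h
    · simp [hxQ k h]
    · exact mul_nonneg h.le (Complex.normSq_nonneg _)

/-! ### The torus measure -/

theorem surjective_toCircle : Function.Surjective (AddCircle.toCircle : UnitAddCircle → Circle) := by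
  intro z
  obtain ⟨θ, hθ⟩ := Circle.exp_surjective z
  refine ⟨((θ / (2 * Real.pi) : ℝ) : UnitAddCircle), ?_⟩
  rw [AddCircle.toCircle_apply_mk, ← hθ]
  congr 1
  field_simp

/-- The torus measure is the image of the product of the Haar measures on `ℝ / ℤ`. -/
theorem torusMeasure_eq_map :
    torusMeasure m = (Measure.pi fun _ : Fin m => (volume : Measure UnitAddCircle)).map
      (fun x j => AddCircle.toCircle (x j)) := by
  have hpi := measurePreserving_pi _ _ (fun _ : Fin m => AddCircle.measurePreserving_mk (1 : ℝ) 0)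
  rw [← hpi.map_eq, Measure.map_map _ hpi.measurable]
  · have h1 : ((volume : Measure (Fin m → ℝ)).restrict (Set.univ.pi fun _ => Set.Ico (0 : ℝ) 1)) =
        Measure.pi fun _ : Fin m => (volume : Measure ℝ).restrict (Set.Ioc 0 (0 + 1)) := by
      rw [volume_pi, Measure.restrict_pi_pi]
      congr 1
      funext _
      rw [zero_add]
      exact Measure.restrict_congr_set Ico_ae_eq_Ioc
    rw [torusMeasure, h1]
    congr 1
    funext θ j
    simp [torusExp, AddCircle.toCircle_apply_mk]
  · exact measurable_pi_lambda _ fun j =>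
      (AddCircle.continuous_toCircle.measurable).comp (measurable_pi_apply j)

instance isMulLeftInvariant_torusMeasure : (torusMeasure m).IsMulLeftInvariant := by
  constructor
  intro w
  choose a ha using fun j => surjective_toCircle (w j)
  have hmeas : Measurable fun (x : Fin m → UnitAddCircle) j => AddCircle.toCircle (x j) :=
    measurable_pi_lambda _ fun j =>
      (AddCircle.continuous_toCircle.measurable).comp (measurable_pi_apply j)
  rw [torusMeasure_eq_map, Measure.map_map (measurable_const_mul w) hmeas]
  conv_rhs => rw [← map_add_left_eq_self (Measure.pi fun _ : Fin m =>
    (volume : Measure UnitAddCircle)) a]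
  rw [Measure.map_map hmeas (measurable_const_add a)]
  congr 1
  funext x j
  simp [AddCircle.toCircle_add, ha]

theorem measurableSet_laurentEval_nonpos (f : AddMonoidAlgebra ℂ (Fin m → ℤ)) :
    MeasurableSet {z : Fin m → Circle | (laurentEval f z).re ≤ 0} :=
  (isClosed_le (Complex.continuous_re.comp (continuous_laurentEval f))
    continuous_const).measurableSet

/-- Averaging the inertia bound over all translates of the grid of roots of unity turns the count
of non-positive eigenvalues into the measure of `{f ≤ 0}`. -/
theorem indepNum_le_measureReal_nonpos {n : ℕ} (hn : n ≠ 0) {D : Finset (Fin m → ℤ)}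
    {f : AddMonoidAlgebra ℂ (Fin m → ℤ)} (hf : ∀ d, d ∉ D → f.coeff d = 0) :
    (indepNum (circulantGraph D n) : ℝ) ≤
      (n : ℝ) ^ m * (torusMeasure m).real {z | (laurentEval f z).re ≤ 0} := by
  classical
  set K := {z : Fin m → Circle | (laurentEval f z).re ≤ 0} with hK
  have hKm : MeasurableSet K := measurableSet_laurentEval_nonpos f
  have hpt (w : Fin m → Circle) : (indepNum (circulantGraph D n) : ℝ) ≤
      ∑ k : Fin m → Fin n, ((· * rootPoint n k) ⁻¹' K).indicator 1 w := by
    have h1 : indepNum (circulantGraph D n) ≤ (Finset.univ.filter fun k : Fin m → Fin n =>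
        (laurentEval f (w * rootPoint n k)).re ≤ 0).card :=
      Finset.sup_le fun S hS =>
        card_le_card_laurentEval_nonpos hn hf (Finset.mem_filter.1 hS).2 w
    refine (Nat.cast_le.2 h1).trans (le_of_eq ?_)
    simp [Set.indicator_apply, hK]
  have hm (k : Fin m → Fin n) : MeasurableSet ((· * rootPoint n k) ⁻¹' K) :=
    (measurable_mul_const _) hKm
  have hint := integral_mono (μ := torusMeasure m) (integrable_const _)
    (integrable_finsetSum _ fun k _ => (integrable_const (1 : ℝ)).indicator (hm k)) hpt
  rw [integral_const, integral_finsetSum _ fun k _ =>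
    (integrable_const (1 : ℝ)).indicator (hm k)] at hint
  have hk (k : Fin m → Fin n) :
      ∫ w, ((· * rootPoint n k) ⁻¹' K).indicator (1 : (Fin m → Circle) → ℝ) w
        ∂(torusMeasure m) =
        (torusMeasure m).real K := by
    rw [integral_indicator_one (hm k), measureReal_def, measure_preimage_mul_right,
      measureReal_def]
  simp_rw [← Pi.one_def, hk] at hint
  simpa using hint

/-! ### Zero sets of Laurent polynomials are null sets -/

/-- A finite set of integer vectors is mapped injectively to `ℤ` by some linear form. -/
theorem exists_dotProduct_injOn (D : Finset (Fin m → ℤ)) :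
    ∃ a : Fin m → ℤ, Set.InjOn (fun d : Fin m → ℤ => a ⬝ᵥ d) D := by
  -- The form `v ↦ ∑ j, v j * B ^ j` works for all integers `B` that are not roots of the
  -- polynomials `∑ j, (d j - e j) X ^ j` with `d ≠ e`.
  classical
  let p (v : Fin m → ℤ) : Polynomial ℤ := ∑ j, Polynomial.C (v j) * Polynomial.X ^ (j : ℕ)
  have hp (v : Fin m → ℤ) (hv : p v = 0) : v = 0 := by
    funext i
    have := congrArg (fun q => Polynomial.coeff q (i : ℕ)) hv
    simpa [p, Polynomial.finsetSum_coeff, Polynomial.coeff_C_mul, Polynomial.coeff_X_pow,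
      Fin.val_inj] using this
  have hprod : ∏ de ∈ D.offDiag, p (de.1 - de.2) ≠ 0 :=
    Finset.prod_ne_zero_iff.2 fun de hde h =>
      (Finset.mem_offDiag.1 hde).2.2 (sub_eq_zero.1 (hp _ h))
  obtain ⟨B, hB⟩ : ∃ B, (∏ de ∈ D.offDiag, p (de.1 - de.2)).eval B ≠ 0 := by
    by_contra! h
    exact hprod (Polynomial.funext fun B => by simp [h B])
  refine ⟨fun j => B ^ (j : ℕ), fun d hd e he hde => by_contra fun hne => ?_⟩
  rw [Polynomial.eval_prod, Finset.prod_ne_zero_iff] at hB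
  refine hB (d, e) (Finset.mem_offDiag.2 ⟨hd, he, hne⟩) ?_
  rw [← sub_eq_zero] at hde
  simpa [p, Polynomial.eval_finsetSum, dotProduct, sub_mul, Finset.sum_sub_distrib,
    mul_comm] using hde

theorem finite_zeros_sum_zpow {ι : Type*} {D : Finset ι} {b : ι → ℂ} {e : ι → ℤ}
    (he : Set.InjOn e D) (hb : ∃ d ∈ D, b d ≠ 0) :
    {t : Circle | ∑ d ∈ D, b d * (t : ℂ) ^ e d = 0}.Finite := by
  classical
  obtain ⟨K, hK⟩ : ∃ K : ℤ, ∀ d ∈ D, 0 ≤ e d + K := by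
    refine ⟨∑ d ∈ D, |e d|, fun d hd => ?_⟩
    have := Finset.single_le_sum (f := fun d => |e d|) (fun i _ => abs_nonneg _) hd
    have := neg_abs_le (e d)
    linarith
  let p : Polynomial ℂ := ∑ d ∈ D, Polynomial.C (b d) * Polynomial.X ^ (e d + K).toNat
  have hp : p ≠ 0 := by
    obtain ⟨d, hd, hbd⟩ := hb
    intro h
    have h1 := congrArg (fun q => Polynomial.coeff q (e d + K).toNat) h
    simp only [p, Polynomial.finsetSum_coeff, Polynomial.coeff_C_mul, Polynomial.coeff_X_pow,
      Polynomial.coeff_zero] at h1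
    rw [Finset.sum_eq_single_of_mem d hd] at h1
    · simp [hbd] at h1
    · intro d' hd' hne
      have := hK d hd
      have := hK d' hd'
      rw [if_neg, mul_zero]
      intro h2
      exact hne (he hd' hd (by omega))
  refine Set.Finite.preimage Subtype.val_injective.injOn
    (p.roots.toFinset.finite_toSet) |>.subset fun t ht => ?_
  simp only [Set.mem_preimage, Finset.mem_coe, Multiset.mem_toFinset, Polynomial.mem_roots hp,
    Polynomial.IsRoot.def]
  have hval : p.eval (t : ℂ) = (t : ℂ) ^ K * ∑ d ∈ D, b d * (t : ℂ) ^ e d := by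
    simp only [p, Polynomial.eval_finsetSum, Polynomial.eval_mul, Polynomial.eval_C,
      Polynomial.eval_pow, Polynomial.eval_X, Finset.mul_sum]
    refine Finset.sum_congr rfl fun d hd => ?_
    rw [← zpow_natCast, Int.toNat_of_nonneg (hK d hd), zpow_add₀ (Circle.coe_ne_zero t)]
    ring
  have ht' : ∑ d ∈ D, b d * (t : ℂ) ^ e d = 0 := ht
  exact hval.trans (by rw [ht', mul_zero])

theorem countable_preimage_exp {s : Set Circle} (hs : s.Finite) :
    (Circle.exp ⁻¹' s).Countable := by
  rw [← Set.biUnion_preimage_singleton]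
  refine hs.countable.biUnion fun z _ => ?_
  obtain ⟨θ, rfl⟩ := Circle.exp_surjective z
  refine (Set.countable_range fun k : ℤ => θ + k * (2 * Real.pi)).mono fun x hx => ?_
  obtain ⟨k, hk⟩ := Circle.exp_eq_exp.1 hx
  exact ⟨k, hk.symm⟩

/-- The zero set of a non-zero Laurent polynomial is a null set of the torus. By invariance, its
measure is that of almost every translate along a one-parameter subgroup `θ ↦ exp (i θ a)`; when
`a` separates the exponents of `f`, each orbit of this subgroup meets the zero set in a countable
set, and Fubini applies. -/
theorem torusMeasure_laurentEval_eq_zero {f : AddMonoidAlgebra ℂ (Fin m → ℤ)} (hf : f ≠ 0) :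
    torusMeasure m {z | laurentEval f z = 0} = 0 := by
  set D := f.coeff.support with hD
  have heval := laurentEval_eq_sum (f := f) (D := D) fun d hd => Finsupp.notMem_support_iff.1 hd
  obtain ⟨a, ha⟩ := exists_dotProduct_injOn D
  let γ (θ : ℝ) : Fin m → Circle := fun j => Circle.exp θ ^ a j
  have hγ (d : Fin m → ℤ) (θ : ℝ) :
      (torusMonomial d (γ θ) : ℂ) = (Circle.exp θ : ℂ) ^ (a ⬝ᵥ d) := by
    rw [← Circle.coe_zpow]
    congr 1
    simp only [torusMonomial, γ, dotProduct, ← zpow_mul]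
    exact (map_sum (zmultiplesHom (Additive Circle) (Additive.ofMul (Circle.exp θ)))
      (fun i => a i * d i) Finset.univ).symm
  have hγc : Continuous γ := continuous_pi fun j => (Circle.exp.continuous).zpow _
  let E : Set (ℝ × (Fin m → Circle)) := {p | laurentEval f (γ p.1 * p.2) = 0}
  have hE : MeasurableSet E := by
    refine (isClosed_eq ((continuous_laurentEval f).comp ?_) continuous_const).measurableSet
    exact (hγc.comp continuous_fst).mul continuous_snd
  have hnull : ((volume : Measure ℝ).prod (torusMeasure m)) E = 0 := by
    rw [← Measure.prod_swap, Measure.map_apply measurable_swap hE,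
      Measure.measure_prod_null (measurable_swap hE)]
    refine Eventually.of_forall fun z => ?_
    have hne : ∃ d ∈ D, f.coeff d * (torusMonomial d z : ℂ) ≠ 0 := by
      obtain ⟨d, hd⟩ := Finsupp.support_nonempty_iff.2
        (show f.coeff ≠ 0 from fun h => hf (AddMonoidAlgebra.coeff_eq_zero.1 h))
      exact ⟨d, hd, mul_ne_zero (Finsupp.mem_support_iff.1 hd) (Circle.coe_ne_zero _)⟩
    refine Set.Countable.measure_zero
      ((countable_preimage_exp (finite_zeros_sum_zpow ha hne)).mono fun θ hθ => ?_) _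
    have hθ' : laurentEval f (γ θ * z) = 0 := hθ
    rw [heval] at hθ'
    simp only [Set.mem_preimage, Set.mem_ofPred_eq]
    rw [← hθ']
    refine Finset.sum_congr rfl fun d _ => ?_
    rw [torusMonomial_mul, Circle.coe_mul, hγ]
    ring
  rw [Measure.measure_prod_null hE] at hnull
  obtain ⟨θ, hθ⟩ := hnull.exists
  rw [← measure_preimage_mul (torusMeasure m) (γ θ)]
  exact hθ

/-! ### The bound at finite level -/

variable {D : Finset (Fin m → ℤ)} {f : AddMonoidAlgebra ℂ (Fin m → ℤ)}

theorem ae_laurentEval_re_ne_zero (hD : ∀ d ∈ D, -d ∈ D) (hf : IsAdmissible D f) :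
    ∀ᵐ z ∂torusMeasure m, (laurentEval f z).re ≠ 0 := by
  have h : ∀ᵐ z ∂torusMeasure m, laurentEval f z ≠ 0 := by
    simpa [ae_iff] using torusMeasure_laurentEval_eq_zero hf.ne_zero
  filter_upwards [h] with z hz hre
  exact hz (Complex.ext hre (laurentEval_im hD hf z))

theorem IsAdmissible.neg (hf : IsAdmissible D f) : IsAdmissible D (-f) where
  ne_zero := neg_ne_zero.2 hf.ne_zero
  supported d hd := by simp [hf.supported d hd]
  conj_symm d hd := by simp [hf.conj_symm d hd]

theorem rhoNeg_neg (hf : IsAdmissible D f) : rhoNeg (-f) = rhoPos f := by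
  have h (z : Fin m → Circle) : laurentEval (-f) z = -laurentEval f z := by
    simp [laurentEval_eq_sum hf.neg.supported, laurentEval_eq_sum hf.supported]
  simp [rhoNeg, rhoPos, h]

theorem indepRatio_le_rhoNeg (hD : ∀ d ∈ D, -d ∈ D) (hf : IsAdmissible D f) {n : ℕ}
    (hn : n ≠ 0) : indepRatio D n ≤ rhoNeg f := by
  have h1 : (torusMeasure m).real {z | (laurentEval f z).re ≤ 0} = rhoNeg f := by
    refine measureReal_congr ?_
    filter_upwards [ae_laurentEval_re_ne_zero hD hf] with z hz
    exact propext ⟨fun h => lt_of_le_of_ne h hz, fun h => le_of_lt h⟩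
  rw [indepRatio, div_le_iff₀ (by positivity), ← h1, mul_comm]
  exact indepNum_le_measureReal_nonpos hn hf.supported

theorem indepRatio_le_min_rho (hD : ∀ d ∈ D, -d ∈ D) (hf : IsAdmissible D f) {n : ℕ}
    (hn : n ≠ 0) : indepRatio D n ≤ min (rhoPos f) (rhoNeg f) :=
  le_min (rhoNeg_neg hf ▸ indepRatio_le_rhoNeg hD hf.neg hn) (indepRatio_le_rhoNeg hD hf hn)

/-! ### Existence of the limit -/

section Limit

theorem exists_isIndependent_card_eq_indepNum {V : Type*} [Fintype V] (G : Digraph V) :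
    ∃ S : Finset V, IsIndependent G S ∧ S.card = indepNum G := by
  classical
  have hne : (Finset.univ.filter fun S : Finset V => IsIndependent G S).Nonempty :=
    ⟨∅, Finset.mem_filter.2 ⟨Finset.mem_univ _, by simp [IsIndependent]⟩⟩
  obtain ⟨S, hS, hc⟩ := Finset.exists_mem_eq_sup _ hne Finset.card
  exact ⟨S, (Finset.mem_filter.1 hS).2, hc.symm⟩

theorem card_le_indepNum {V : Type*} [Fintype V] {G : Digraph V} {S : Finset V}
    (hS : IsIndependent G S) : S.card ≤ indepNum G := by
  classical
  exact Finset.le_sup (f := Finset.card) (by simpa using hS)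

theorem indepNum_le_card {V : Type*} [Fintype V] (G : Digraph V) :
    indepNum G ≤ Fintype.card V :=
  Finset.sup_le fun S _ => S.card_le_univ

/-- Blocks of side `n` followed by gaps of width `R` fit into `{0, …, N - 1}`, the last gap
included. -/
theorem blockCoord_lt {N n R : ℕ} (a : Fin (N / (n + R))) (u : Fin n) :
    (a : ℕ) * (n + R) + u + R < N := by
  have h1 : ((a : ℕ) + 1) * (n + R) ≤ N :=
    (Nat.mul_le_mul_right _ a.2).trans (Nat.div_mul_le_self _ _)
  have := u.2
  linarith

/-- Translates of an independent set of `G_n`, placed in the blocks of a grid in `G_N` with gaps of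
width `R ≥ max |d_i|` between them, form an independent set. -/
theorem pow_mul_indepNum_le {D : Finset (Fin m → ℤ)} {R : ℕ}
    (hR : ∀ d ∈ D, ∀ i, |d i| ≤ (R : ℤ)) (n N : ℕ) :
    (N / (n + R)) ^ m * indepNum (circulantGraph D n) ≤ indepNum (circulantGraph D N) := by
  classical
  obtain ⟨S, hS, hc⟩ := exists_isIndependent_card_eq_indepNum (circulantGraph D n)
  let φ (p : (Fin m → Fin (N / (n + R))) × (Fin m → Fin n)) : Fin m → Fin N := fun j =>
    ⟨(p.1 j : ℕ) * (n + R) + p.2 j, (Nat.le_add_right _ R).trans_lt (blockCoord_lt _ _)⟩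
  -- Two vertices of `G_N` in blocks that differ from each other are too far apart to be adjacent.
  have hblock (a b : ℕ) (u v : Fin n) (t : ℤ) (ht : |t| ≤ R)
      (h : ((a * (n + R) + u : ℕ) : ℤ) - ((b * (n + R) + v : ℕ) : ℤ) = t) : a = b := by
    have hu := u.2
    have hv := v.2
    have ⟨ht1, ht2⟩ := abs_le.1 ht
    push_cast at h
    rcases lt_trichotomy a b with hab | hab | hab
    · have : ((a : ℤ) + 1) * (n + R) ≤ b * (n + R) :=
        mul_le_mul_of_nonneg_right (by omega) (by positivity)
      linarith
    · exact hab
    · have : ((b : ℤ) + 1) * (n + R) ≤ a * (n + R) :=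
        mul_le_mul_of_nonneg_right (by omega) (by positivity)
      linarith
  have hinj : Function.Injective φ := by
    rintro ⟨a, u⟩ ⟨b, v⟩ h
    have hj (j : Fin m) : (a j : ℕ) * (n + R) + u j = (b j : ℕ) * (n + R) + v j :=
      congrArg Fin.val (congrFun h j)
    have hab (j : Fin m) : (a j : ℕ) = b j :=
      hblock _ _ (u j) (v j) 0 (by simp) (sub_eq_zero.2 (congrArg Nat.cast (hj j)))
    refine Prod.ext (funext fun j => Fin.ext (hab j)) (funext fun j => Fin.ext ?_)
    have := hj j
    rw [hab j] at this
    simpa using this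
  have hT : IsIndependent (circulantGraph D N) ((Finset.univ ×ˢ S).image φ) := by
    intro x hx y hy hxy
    obtain ⟨⟨a, u⟩, hau, rfl⟩ := Finset.mem_image.1 hx
    obtain ⟨⟨b, v⟩, hbv, rfl⟩ := Finset.mem_image.1 hy
    obtain ⟨d, hd, hdd⟩ := hxy
    -- The gap at the end of the last block turns the congruence modulo `N` into an equality.
    have heq (j : Fin m) : (((a j : ℕ) * (n + R) + u j : ℕ) : ℤ) -
        (((b j : ℕ) * (n + R) + v j : ℕ) : ℤ) = d j := by
      have h1 := blockCoord_lt (a j) (u j)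
      have h2 := blockCoord_lt (b j) (v j)
      have ⟨h3, h4⟩ := abs_le.1 (hR d hd j)
      have h5 : (N : ℤ) ∣ d j - ((((a j : ℕ) * (n + R) + u j : ℕ) : ℤ) -
        (((b j : ℕ) * (n + R) + v j : ℕ) : ℤ)) := (hdd j).dvd
      have h6 := Int.eq_zero_of_abs_lt_dvd h5 (by rw [abs_lt]; constructor <;> omega)
      linarith
    refine hS u (Finset.mem_product.1 hau).2 v (Finset.mem_product.1 hbv).2 ⟨d, hd, fun j => ?_⟩
    have hab := hblock _ _ (u j) (v j) (d j) (hR d hd j) (heq j)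
    have := heq j
    rw [hab] at this
    push_cast at this
    rw [show ((u j : ℕ) : ℤ) - ((v j : ℕ) : ℤ) = d j by linarith]
  calc (N / (n + R)) ^ m * indepNum (circulantGraph D n)
      = ((Finset.univ ×ˢ S).image φ).card := by
        rw [Finset.card_image_of_injective _ hinj, Finset.card_product, hc]
        simp
    _ ≤ _ := card_le_indepNum hT

theorem tendsto_natDiv_div_atTop {M : ℕ} (hM : 0 < M) :
    Tendsto (fun N : ℕ => ((N / M : ℕ) : ℝ) / N) atTop (𝓝 (1 / M)) := by
  have h := (tendsto_nat_floor_mul_div_atTop (R := ℝ) (a := 1 / M) (by positivity)).comp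
    tendsto_natCast_atTop_atTop
  refine h.congr fun N => ?_
  rw [Function.comp_apply, one_div, inv_mul_eq_div, Nat.floor_div_eq_div]

/-- The limit of `α(G_n) / n^m` exists. It is the supremum of `α(G_n) / (n + R)^m`. -/
theorem exists_tendsto_indepRatio (D : Finset (Fin m → ℤ)) :
    ∃ L, Tendsto (indepRatio D) atTop (𝓝 L) := by
  obtain ⟨R, hR⟩ : ∃ R : ℕ, ∀ d ∈ D, ∀ i, |d i| ≤ (R : ℤ) := by
    refine ⟨∑ d ∈ D, ∑ i, (d i).natAbs, fun d hd i => ?_⟩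
    rw [Int.abs_eq_natAbs, Nat.cast_le]
    exact (Finset.single_le_sum (f := fun i => (d i).natAbs) (fun _ _ => Nat.zero_le _)
      (Finset.mem_univ i)).trans
      (Finset.single_le_sum (f := fun d : Fin m → ℤ => ∑ i, (d i).natAbs)
        (fun _ _ => Nat.zero_le _) hd)
  -- The shift by one keeps the denominator positive also when `R = 0`.
  let b (n : ℕ) : ℝ := (indepNum (circulantGraph D (n + 1)) : ℝ) / ((n + 1 + R : ℕ) : ℝ) ^ m
  have hb : BddAbove (Set.range b) := by
    refine ⟨1, ?_⟩
    rintro _ ⟨n, rfl⟩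
    have h1 := indepNum_le_card (circulantGraph D (n + 1))
    rw [Fintype.card_fun, Fintype.card_fin, Fintype.card_fin] at h1
    refine div_le_one_of_le₀ ?_ (by positivity)
    exact_mod_cast h1.trans (Nat.pow_le_pow_left (by omega) m)
  refine ⟨⨆ n, b n, tendsto_order.2 ⟨fun x hx => ?_, fun x hx => ?_⟩⟩
  · obtain ⟨n, hn⟩ := exists_lt_of_lt_ciSup hx
    have hlim : Tendsto (fun N : ℕ => (((N / (n + 1 + R) : ℕ) : ℝ) / N) ^ m *
        indepNum (circulantGraph D (n + 1))) atTop (𝓝 (b n)) := by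
      have := ((tendsto_natDiv_div_atTop (M := n + 1 + R) (by omega)).pow m).mul_const
        (indepNum (circulantGraph D (n + 1)) : ℝ)
      rwa [one_div, inv_pow, inv_mul_eq_div] at this
    filter_upwards [hlim.eventually_const_lt hn] with N hN
    refine hN.trans_le ?_
    rw [div_pow, div_mul_eq_mul_div, indepRatio]
    gcongr
    exact_mod_cast pow_mul_indepNum_le hR (n + 1) N
  · have hlim : Tendsto (fun n : ℕ => (⨆ n, b n) * (1 + (R : ℝ) / n) ^ m) atTop
        (𝓝 (⨆ n, b n)) := by
      have := (((tendsto_const_div_atTop_nhds_zero_nat (R : ℝ)).const_add 1).pow m).const_mul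
        (⨆ n, b n)
      simpa using this
    filter_upwards [hlim.eventually_lt_const hx, eventually_gt_atTop 0] with n hn hn0
    refine lt_of_le_of_lt ?_ hn
    obtain ⟨k, rfl⟩ := Nat.exists_eq_succ_of_ne_zero hn0.ne'
    have h1 : (indepNum (circulantGraph D (k + 1)) : ℝ) / ((k + 1 + R : ℕ) : ℝ) ^ m ≤ ⨆ n, b n :=
      le_ciSup hb k
    rw [div_le_iff₀ (by positivity)] at h1
    have h2 : (1 + (R : ℝ) / (k + 1 : ℕ)) * (k + 1 : ℕ) = ((k + 1 + R : ℕ) : ℝ) := by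
      push_cast
      field_simp
    rwa [indepRatio, div_le_iff₀ (by positivity), mul_assoc, ← mul_pow, h2]

theorem tendsto_indepRatio (D : Finset (Fin m → ℤ)) :
    Tendsto (indepRatio D) atTop (𝓝 (alpha D)) :=
  tendsto_nhds_limUnder (exists_tendsto_indepRatio D)

theorem alpha_le_min_rho {D : Finset (Fin m → ℤ)} (hD : ∀ d ∈ D, -d ∈ D)
    {f : AddMonoidAlgebra ℂ (Fin m → ℤ)} (hf : IsAdmissible D f) :
    alpha D ≤ min (rhoPos f) (rhoNeg f) :=
  le_of_tendsto (tendsto_indepRatio D)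
    ((eventually_ne_atTop 0).mono fun _ hn => indepRatio_le_min_rho hD hf hn)

end Limit

/-! ### Attainment of the minimum -/

section Minimum

/-- The Laurent polynomial with exponents in `D` and prescribed coefficients. -/
noncomputable def ofCoeffs (D : Finset (Fin m → ℤ)) (c : D → ℂ) :
    AddMonoidAlgebra ℂ (Fin m → ℤ) :=
  ∑ d : D, AddMonoidAlgebra.single (d : Fin m → ℤ) (c d)

theorem coeff_ofCoeffs (c : D → ℂ) (d : D) : (ofCoeffs D c).coeff d = c d := by
  classical
  simp [ofCoeffs, AddMonoidAlgebra.coeff_sum, Finsupp.finsetSum_apply, Finsupp.single_apply]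

theorem coeff_ofCoeffs_of_notMem (c : D → ℂ) {d : Fin m → ℤ} (hd : d ∉ D) :
    (ofCoeffs D c).coeff d = 0 := by
  classical
  rw [ofCoeffs, AddMonoidAlgebra.coeff_sum, Finsupp.finsetSum_apply]
  refine Finset.sum_eq_zero fun e _ => ?_
  rw [AddMonoidAlgebra.coeff_single, Finsupp.single_eq_of_ne]
  rintro rfl
  exact hd e.2

theorem laurentEval_ofCoeffs (c : D → ℂ) (z : Fin m → Circle) :
    laurentEval (ofCoeffs D c) z = ∑ d : D, c d * (torusMonomial (d : Fin m → ℤ) z : ℂ) := by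
  rw [laurentEval_eq_sum fun d hd => coeff_ofCoeffs_of_notMem c hd, ← Finset.sum_coe_sort]
  exact Finset.sum_congr rfl fun d _ => by rw [coeff_ofCoeffs]

theorem ofCoeffs_coeff {f : AddMonoidAlgebra ℂ (Fin m → ℤ)} (hf : IsAdmissible D f) :
    ofCoeffs D (fun d => f.coeff d) = f := by
  refine AddMonoidAlgebra.coeff_injective (Finsupp.ext fun d => ?_)
  by_cases hd : d ∈ D
  · exact coeff_ofCoeffs _ ⟨d, hd⟩
  · rw [coeff_ofCoeffs_of_notMem _ hd, hf.supported d hd]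

/-- Coefficient vectors of norm one that satisfy the symmetry `c_{-d} = conj c_d`. -/
def unitCoeffs (D : Finset (Fin m → ℤ)) : Set (D → ℂ) :=
  {c | ‖c‖ = 1 ∧ ∀ d e : D, (e : Fin m → ℤ) = -d → c e = starRingEnd ℂ (c d)}

theorem isCompact_unitCoeffs (D : Finset (Fin m → ℤ)) : IsCompact (unitCoeffs D) := by
  have h : unitCoeffs D = Metric.sphere 0 1 ∩
      ⋂ (d : D) (e : D) (_ : (e : Fin m → ℤ) = -d), {c | c e = starRingEnd ℂ (c d)} := by
    ext c
    simp [unitCoeffs]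
  rw [h]
  refine (isCompact_sphere 0 1).inter_right (isClosed_iInter fun d => isClosed_iInter fun e =>
    isClosed_iInter fun _ => isClosed_eq (continuous_apply e) ?_)
  exact Complex.continuous_conj.comp (continuous_apply d)

theorem isAdmissible_ofCoeffs (hD : ∀ d ∈ D, -d ∈ D) {c : D → ℂ} (hc : c ∈ unitCoeffs D) :
    IsAdmissible D (ofCoeffs D c) where
  ne_zero h := by
    have h0 : c = 0 := funext fun d => by rw [← coeff_ofCoeffs c d, h]; simp
    simpa [h0] using hc.1
  supported d hd := coeff_ofCoeffs_of_notMem c hd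
  conj_symm d hd := by
    rw [coeff_ofCoeffs c ⟨d, hd⟩, coeff_ofCoeffs c ⟨-d, hD d hd⟩]
    exact hc.2 ⟨d, hd⟩ ⟨-d, hD d hd⟩ rfl

theorem measurable_laurentEval_re (f : AddMonoidAlgebra ℂ (Fin m → ℤ)) :
    Measurable fun z => (laurentEval f z).re :=
  (Complex.continuous_re.comp (continuous_laurentEval f)).measurable

theorem tendsto_laurentEval_ofCoeffs_re (c : D → ℂ) (z : Fin m → Circle) :
    Tendsto (fun c' => (laurentEval (ofCoeffs D c') z).re) (𝓝 c)
      (𝓝 (laurentEval (ofCoeffs D c) z).re) := by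
  simp_rw [laurentEval_ofCoeffs]
  refine Continuous.tendsto (f := fun c' : D → ℂ =>
    (∑ d : D, c' d * (torusMonomial (d : Fin m → ℤ) z : ℂ)).re) ?_ c
  fun_prop

/-- Since the zero set of an admissible `f` is a null set, the sign of `f` at almost every point
persists under small changes of the coefficients; hence `ρ₊` is continuous. -/
theorem continuousOn_rhoPos_ofCoeffs (hD : ∀ d ∈ D, -d ∈ D) :
    ContinuousOn (fun c => rhoPos (ofCoeffs D c)) (unitCoeffs D) := by
  intro c hc
  refine ContinuousAt.continuousWithinAt ?_
  refine (ENNReal.tendsto_toReal (measure_ne_top _ _)).comp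
    (tendsto_measure_of_ae_tendsto_indicator_of_isFiniteMeasure _
      (measurableSet_lt measurable_const (measurable_laurentEval_re _))
      (fun c' => measurableSet_lt measurable_const (measurable_laurentEval_re _)) ?_)
  filter_upwards [ae_laurentEval_re_ne_zero hD (isAdmissible_ofCoeffs hD hc)] with z hz
  rcases lt_or_gt_of_ne hz with h | h
  · filter_upwards [(tendsto_laurentEval_ofCoeffs_re c z).eventually_lt_const h] with c' hc'
    exact iff_of_false hc'.not_gt h.not_gt
  · filter_upwards [(tendsto_laurentEval_ofCoeffs_re c z).eventually_const_lt h] with c' hc'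
    exact iff_of_true hc' h

theorem ofCoeffs_neg (c : D → ℂ) : ofCoeffs D (-c) = -ofCoeffs D c := by
  simp [ofCoeffs]

theorem neg_mem_unitCoeffs {c : D → ℂ} (hc : c ∈ unitCoeffs D) : -c ∈ unitCoeffs D :=
  ⟨by simp [hc.1], fun d e h => by simp [hc.2 d e h]⟩

theorem continuousOn_rhoNeg_ofCoeffs (hD : ∀ d ∈ D, -d ∈ D) :
    ContinuousOn (fun c => rhoNeg (ofCoeffs D c)) (unitCoeffs D) := by
  refine ((continuousOn_rhoPos_ofCoeffs hD).comp continuous_neg.continuousOn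
    fun c hc => neg_mem_unitCoeffs hc).congr fun c hc => ?_
  have h := rhoNeg_neg (isAdmissible_ofCoeffs hD (neg_mem_unitCoeffs hc))
  rwa [ofCoeffs_neg, neg_neg, ← ofCoeffs_neg] at h

theorem unitCoeffs_nonempty (hne : D.Nonempty) :
    (unitCoeffs D).Nonempty := by
  have : Nonempty D := hne.to_subtype
  exact ⟨fun _ => 1, by simp, fun _ _ _ => by simp⟩

theorem exists_unitCoeffs_rho_eq {f : AddMonoidAlgebra ℂ (Fin m → ℤ)}
    (hf : IsAdmissible D f) : ∃ c ∈ unitCoeffs D,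
      rhoPos (ofCoeffs D c) = rhoPos f ∧ rhoNeg (ofCoeffs D c) = rhoNeg f := by
  set c : D → ℂ := fun d => f.coeff d with hc
  have hfc : ofCoeffs D c = f := ofCoeffs_coeff hf
  have hc0 : 0 < ‖c‖ := norm_pos_iff.2 fun h => hf.ne_zero (by simp [← hfc, h, ofCoeffs])
  have heval (z : Fin m → Circle) :
      (laurentEval (ofCoeffs D (‖c‖⁻¹ • c)) z).re = ‖c‖⁻¹ * (laurentEval f z).re := by
    rw [← hfc, laurentEval_ofCoeffs, laurentEval_ofCoeffs, ← Complex.re_ofReal_mul,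
      Finset.mul_sum]
    simp [mul_assoc]
  refine ⟨‖c‖⁻¹ • c, ⟨?_, fun d e h => ?_⟩, ?_, ?_⟩
  · rw [norm_smul, norm_inv, norm_norm, inv_mul_cancel₀ hc0.ne']
  · simp [hc, h, hf.conj_symm d d.2]
  · simp_rw [rhoPos, heval, mul_pos_iff_of_pos_left (inv_pos.2 hc0)]
  · simp_rw [rhoNeg, heval, ← neg_pos (a := ‖c‖⁻¹ * _), ← mul_neg,
      mul_pos_iff_of_pos_left (inv_pos.2 hc0), neg_pos]

theorem isLeast_rho (hD : ∀ d ∈ D, -d ∈ D) (hne : D.Nonempty) :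
    IsLeast (rhoValues D) (rho D) := by
  obtain ⟨c, hc, hmin⟩ := (isCompact_unitCoeffs D).exists_isMinOn (unitCoeffs_nonempty hne)
    ((continuousOn_rhoPos_ofCoeffs hD).inf (continuousOn_rhoNeg_ofCoeffs hD))
  have h : IsLeast (rhoValues D) (min (rhoPos (ofCoeffs D c)) (rhoNeg (ofCoeffs D c))) := by
    refine ⟨⟨_, isAdmissible_ofCoeffs hD hc, rfl⟩, ?_⟩
    rintro _ ⟨f, hf, rfl⟩
    obtain ⟨c', hc', h1, h2⟩ := exists_unitCoeffs_rho_eq hf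
    rw [← h1, ← h2]
    exact hmin hc'
  rw [rho, h.csInf_eq]
  exact h

end Minimum

end MCirculant

theorem mainTheorem3 {m : ℕ} (D : Finset (Fin m → ℤ)) (h0 : (0 : Fin m → ℤ) ∉ D)
    (hsymm : ∀ d ∈ D, -d ∈ D) :
    Tendsto (MCirculant.indepRatio D) atTop (𝓝 (MCirculant.alpha D)) ∧
    (∀ f : AddMonoidAlgebra ℂ (Fin m → ℤ), MCirculant.IsAdmissible D f →
      MCirculant.alpha D ≤ min (MCirculant.rhoPos f) (MCirculant.rhoNeg f)) ∧
    (D.Nonempty →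
      IsLeast (MCirculant.rhoValues D) (MCirculant.rho D) ∧
      MCirculant.alpha D ≤ MCirculant.rho D) := by
  refine ⟨MCirculant.tendsto_indepRatio D, fun f hf => MCirculant.alpha_le_min_rho hsymm hf,
    fun hne => ?_⟩
  have hleast := MCirculant.isLeast_rho hsymm hne
  refine ⟨hleast, ?_⟩
  obtain ⟨f, hf, h⟩ := hleast.1
  exact h ▸ MCirculant.alpha_le_min_rho hsymm hf
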